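/- All rings are commutative with $1$, and $R$ is a ring. A finitely generated ideal $J$ of $R$ is a GV-ideal if the natural map $R\to \mathrm{Hom}_R(J,R)$, $r\mapsto (x\mapsto rx)$, is an isomorphism. An $R$-module $M$ is GV-torsion-free if no nonzero element of $M$ is annihilated by a GV-ideal, and a $w$-module if moreover $\mathrm{Ext}^1_R(R/J,M)=0$ for every GV-ideal $J$. A $w$-ideal is an ideal that is a $w$-module, and $R$ is a DW-ring if every ideal of $R$ is a $w$-ideal. Let $w\text{-}\mathrm{Max}(R)$ be the set of ideals maximal among the proper $w$-ideals; all of them are prime. A sequence $0\to A\to B\to C\to 0$ of $R$-modules is $w$-exact if $0\to A_{\mathfrak p}\to B_{\mathfrak p}\to C_{\mathfrak p}\to 0$ is exact for every $\mathfrak p\in w\text{-}\mathrm{Max}(R)$. A submodule $A\subseteq B$ is $w$-pure if $0\to A\otimes_R N\to B\otimes_R N\to (B/A)\otimes_R N\to 0$ is $w$-exact for every $R$-module $N$. A module $A$ is absolutely $w$-pure if it is a $w$-pure submodule of every $R$-module containing it. An $R$-module $M$ is $w$-FP-projective if $\mathrm{Ext}^1_R(M,A)=0$ for every absolutely $w$-pure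 $R$-module $A$. **Proposition.** Let $(R,\mathfrak m)$ be a local ring (not necessarily Noetherian). If $R$ is not a DW-ring, then every finitely generated $w$-FP-projective $R$-module is free. In particular this applies to regular local rings of global dimension at least $2$: no such ring is a DW-ring. -/

import Mathlib

open CategoryTheory

open scoped TensorProduct

universe u

/-- A Glaz--Vasconcelos ideal: `J` is finitely generated and the natural homomorphism
`R → Hom_R(J, R)`, `r ↦ (x ↦ r x)`, is an isomorphism. -/
def IsGVIdeal {R : Type u} [CommRing R] (J : Ideal R) : Prop :=
  J.FG ∧ Function.Bijective (LinearMap.toSpanSingleton R (J →ₗ[R] R) J.subtype)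

/-- The elements of `M` annihilated by some GV-ideal. -/
def gvTorsion (R : Type u) [CommRing R] (M : Type u) [AddCommGroup M] [Module R M] : Set M :=
  {x | ∃ J : Ideal R, IsGVIdeal J ∧ ∀ a ∈ J, a • x = 0}

/-- `M` is GV-torsion-free. -/
def IsGVTorsionFree (R : Type u) [CommRing R] (M : Type u) [AddCommGroup M] [Module R M] : Prop :=
  gvTorsion R M = {0}

/-- `M` is a `w`-module: it is GV-torsion-free and `Ext¹_R(R/J, M) = 0` for all GV-ideals `J`. -/
def IsWModule (R : Type u) [CommRing R] (M : Type u) [AddCommGroup M] [Module R M] : Prop :=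
  IsGVTorsionFree R M ∧
    ∀ J : Ideal R, IsGVIdeal J →
      Subsingleton (Abelian.Ext (ModuleCat.of R (R ⧸ J)) (ModuleCat.of R M) 1)

/-- A `w`-ideal is an ideal that is a `w`-module. -/
def IsWIdeal {R : Type u} [CommRing R] (I : Ideal R) : Prop :=
  IsWModule R I

/-- A DW-ring: every ideal is a `w`-ideal. -/
def IsDWRing (R : Type u) [CommRing R] : Prop :=
  ∀ I : Ideal R, IsWIdeal I

/-- `p ∈ w-Max(R)`: `p` is maximal among the proper `w`-ideals. -/
def IsMaximalWIdeal {R : Type u} [CommRing R] (p : Ideal R) : Prop :=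
  Maximal (fun I : Ideal R => I ≠ ⊤ ∧ IsWIdeal I) p

/-- `0 → A → B → C → 0` is `w`-exact: it becomes exact after localization at every maximal
`w`-ideal `p`. Every maximal `w`-ideal is prime, so the binder `[p.IsPrime]`, which is
needed to form the localization, excludes none of them. -/
def IsWExact {R : Type u} [CommRing R] {A B C : Type u}
    [AddCommGroup A] [Module R A] [AddCommGroup B] [Module R B] [AddCommGroup C] [Module R C]
    (f : A →ₗ[R] B) (g : B →ₗ[R] C) : Prop :=
  ∀ (p : Ideal R) [p.IsPrime], IsMaximalWIdeal p →
    Function.Injective (LocalizedModule.map p.primeCompl f) ∧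
    Function.Exact (LocalizedModule.map p.primeCompl f) (LocalizedModule.map p.primeCompl g) ∧
    Function.Surjective (LocalizedModule.map p.primeCompl g)

/-- A `w`-exact sequence that stays `w`-exact after tensoring with any module. -/
def IsWPureExact {R : Type u} [CommRing R] {A B C : Type u}
    [AddCommGroup A] [Module R A] [AddCommGroup B] [Module R B] [AddCommGroup C] [Module R C]
    (f : A →ₗ[R] B) (g : B →ₗ[R] C) : Prop :=
  IsWExact f g ∧
    ∀ (M : Type u) [AddCommGroup M] [Module R M], IsWExact (f.rTensor M) (g.rTensor M)

/-- `A` is a `w`-pure submodule of `B`. -/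
def IsWPureSubmodule {R : Type u} [CommRing R] {B : Type u} [AddCommGroup B] [Module R B]
    (A : Submodule R B) : Prop :=
  IsWPureExact A.subtype A.mkQ

/-- `A` is absolutely `w`-pure: it is a `w`-pure submodule of every module that contains it,
that is, its image under every injective homomorphism is a `w`-pure submodule. -/
def IsAbsolutelyWPure (R : Type u) [CommRing R] (A : Type u) [AddCommGroup A] [Module R A] :
    Prop :=
  ∀ (B : Type u) [AddCommGroup B] [Module R B] (f : A →ₗ[R] B),
    Function.Injective f → IsWPureSubmodule (LinearMap.range f)

/-- `M` is `w`-FP-projective: `Ext¹_R(M, A) = 0` for every absolutely `w`-pure module `A`. -/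
def IsWFPProjective (R : Type u) [CommRing R] (M : Type u) [AddCommGroup M] [Module R M] :
    Prop :=
  ∀ (A : Type u) [AddCommGroup A] [Module R A], IsAbsolutelyWPure R A →
    Subsingleton (Abelian.Ext (ModuleCat.of R M) (ModuleCat.of R A) 1)

/-- The global dimension: the supremum of the projective dimensions of all modules. -/
noncomputable def ringGlobalDim (R : Type u) [CommRing R] : WithBot ℕ∞ :=
  ⨆ M : ModuleCat.{u} R, projectiveDimension M

/-!
A finitely generated `w`-FP-projective module `M` is FP-projective, and this already makes it
finitely presented. Let `K` be the kernel of a surjection `F → M` with `F` finite free, and embed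
`K ⧸ P` into an injective module `I_P` for each finitely generated `P ≤ K`. The map
`x ↦ (x mod P)_P` sends `K` to the families in `∏ I_P` that vanish for all large `P`. Such families
form an absolutely pure module, since on a finitely generated submodule truncation is a retraction
from the injective module `∏ I_P`. So the map extends to `F`; as `F` is finitely generated, one
coordinate `P` of the extension vanishes on all of `F`, whence `K = P`.

If `R` is local and not a DW-ring, it has a proper GV-ideal `J`. A module killed by `J` vanishes at
every maximal `w`-ideal, because no such ideal contains `J`; it is therefore absolutely `w`-pure.
This applies to the residue field `k`, so `Ext¹(M, k) = 0`, and the finitely presented module `M` is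
free.

A regular local ring is a domain, by induction on the number of generators of the maximal ideal
`m`: if `x ∈ m` lies neither in `m²` nor in a minimal prime, then `R ⧸ (x)` is again regular, so
`(x)` is prime, and a minimal prime `q ≤ (x)` satisfies `q = x q`, so `q = 0`. If the global
dimension is at least `2`, then `m` is not principal, so it strictly contains `(x)`. A homomorphism
`f : m → R` satisfies `x * f y = y * f x`; choosing `y ∈ m` outside `(x)` gives `x ∣ f x`, and `f`
is multiplication by `f x / x`. Thus `m` is a proper GV-ideal.
-/

section Ext

variable {R : Type u} [CommRing R] {B C N : Type u} [AddCommGroup B] [Module R B]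
  [AddCommGroup C] [Module R C] [AddCommGroup N] [Module R N]

theorem exists_extension_of_subsingleton_ext (g : B →ₗ[R] C) (hg : Function.Surjective g)
    (hN : Subsingleton (Abelian.Ext (ModuleCat.of R C) (ModuleCat.of R N) 1))
    (φ : LinearMap.ker g →ₗ[R] N) :
    ∃ ψ : B →ₗ[R] N, ψ ∘ₗ (LinearMap.ker g).subtype = φ := by
  obtain ⟨ψ, hψ⟩ := Abelian.Ext.contravariant_sequence_exact₁
    (LinearMap.shortExact_shortComplexKer hg) (ModuleCat.of R N)
    (Abelian.Ext.mk₀ (ModuleCat.ofHom φ)) (n₁ := 1) rfl (hN.elim _ _)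
  obtain ⟨ψ, rfl⟩ := Abelian.Ext.homEquiv₀.symm.surjective ψ
  rw [Abelian.Ext.homEquiv₀_symm_apply, Abelian.Ext.mk₀_comp_mk₀] at hψ
  exact ⟨ψ.hom, congrArg ModuleCat.Hom.hom (Abelian.Ext.homEquiv₀.symm.injective hψ)⟩

theorem exists_injective_embedding (R : Type u) [CommRing R] (M : Type u) [AddCommGroup M]
    [Module R M] : ∃ (I : Type u) (_ : AddCommGroup I) (_ : Module R I) (_ : Module.Injective R I)
      (i : M →ₗ[R] I), Function.Injective i := by
  let I := Injective.under (ModuleCat.of R M)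
  exact ⟨I, inferInstance, inferInstance,
    (Module.injective_iff_injective_object R I).mpr (inferInstanceAs (Injective I)),
    (Injective.ι (ModuleCat.of R M)).hom, (ModuleCat.mono_iff_injective _).mp inferInstance⟩

open IsLocalRing in
theorem free_of_subsingleton_ext_residueField {M : Type u} [AddCommGroup M] [Module R M]
    [IsLocalRing R] [Module.FinitePresentation R M]
    (hM : Subsingleton (Abelian.Ext (ModuleCat.of R M) (ModuleCat.of R (ResidueField R)) 1)) :
    Module.Free R M := by
  let k := ResidueField R
  obtain ⟨F, _, _, _, _, g, hg⟩ := Module.exists_finite_presentation R M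
  have : Module.Finite R (LinearMap.ker g) :=
    Module.Finite.iff_fg.mpr (Module.FinitePresentation.fg_ker g hg)
  refine Module.free_of_lTensor_residueField_injective (LinearMap.ker g).subtype g hg
    (LinearMap.exact_subtype_ker_map g) ((injective_iff_map_eq_zero _).mpr fun z hz ↦ ?_)
  -- The vanishing of Ext extends every functional on `k ⊗ ker g` to `k ⊗ F`.
  rw [← Module.forall_dual_apply_eq_zero_iff k]
  intro ξ
  obtain ⟨ψ, hψ⟩ := exists_extension_of_subsingleton_ext g hg hM
    (ξ.restrictScalars R ∘ₗ TensorProduct.mk R k (LinearMap.ker g) 1)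
  have hξ : ξ = ψ.liftBaseChange k ∘ₗ (LinearMap.ker g).subtype.baseChange k := by
    ext x
    simpa using (LinearMap.congr_fun hψ x).symm
  have hz' : (LinearMap.ker g).subtype.baseChange k z = 0 := hz
  rw [hξ, LinearMap.comp_apply, hz', map_zero]

end Ext

section EventuallyZero

/-- The families in `∏ i, M i` that vanish eventually along the filter `l`, i.e. the kernel of the
projection from the product to the reduced product along `l`. -/
def eventuallyZero (R : Type*) [CommRing R] {ι : Type*} (M : ι → Type*)
    [∀ i, AddCommGroup (M i)] [∀ i, Module R (M i)] (l : Filter ι) : Submodule R (∀ i, M i) where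
  carrier := {x | ∀ᶠ i in l, x i = 0}
  zero_mem' := .of_forall fun _ ↦ rfl
  add_mem' hx hy := by
    filter_upwards [hx, hy] with i hxi hyi
    simp [hxi, hyi]
  smul_mem' r x hx := by
    filter_upwards [hx] with i hxi
    simp [hxi]

theorem eventually_forall_mem_apply_eq_zero {R : Type*} [CommRing R] {ι : Type*} {M : ι → Type*}
    [∀ i, AddCommGroup (M i)] [∀ i, Module R (M i)] {l : Filter ι}
    {P : Submodule R (∀ i, M i)} (hP : P.FG) (hPl : P ≤ eventuallyZero R M l) :
    ∀ᶠ i in l, ∀ x ∈ P, x i = 0 := by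
  obtain ⟨s, rfl⟩ := hP
  have hs : ∀ᶠ i in l, ∀ x ∈ s, x i = 0 :=
    (Filter.eventually_all_finset s).mpr fun x hx ↦ hPl (Submodule.subset_span hx)
  filter_upwards [hs] with i hi
  exact Submodule.span_le (p := LinearMap.ker (LinearMap.proj i)).mpr hi

open Filter in
theorem eventually_mkQ_apply_eq_zero {R M : Type*} [CommRing R] [AddCommGroup M] [Module R M]
    (x : M) : ∀ᶠ P : {P : Submodule R M // P.FG} in atTop, P.1.mkQ x = 0 := by
  filter_upwards [eventually_ge_atTop ⟨R ∙ x, Submodule.fg_span_singleton x⟩] with P hP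
  exact (Submodule.Quotient.mk_eq_zero _).mpr (hP (Submodule.mem_span_singleton_self x))

end EventuallyZero

section AbsolutelyPure

variable {R : Type u} [CommRing R]

/-- `A` is absolutely pure: every embedding of `A` stays injective after tensoring with any
module. -/
def IsAbsolutelyPure (R : Type u) [CommRing R] (A : Type u) [AddCommGroup A] [Module R A] :
    Prop :=
  ∀ (B : Type u) [AddCommGroup B] [Module R B] (f : A →ₗ[R] B), Function.Injective f →
    ∀ (N : Type u) [AddCommGroup N] [Module R N], Function.Injective (f.rTensor N)

/-- `M` is FP-projective: `Ext¹_R(M, A) = 0` for every absolutely pure module `A`. -/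
def IsFPProjective (R : Type u) [CommRing R] (M : Type u) [AddCommGroup M] [Module R M] :
    Prop :=
  ∀ (A : Type u) [AddCommGroup A] [Module R A], IsAbsolutelyPure R A →
    Subsingleton (Abelian.Ext (ModuleCat.of R M) (ModuleCat.of R A) 1)

theorem isAbsolutelyPure_of_forall_fg_exists_retraction {A I : Type u} [AddCommGroup A]
    [Module R A] [AddCommGroup I] [Module R I] [Module.Injective R I] (i : A →ₗ[R] I)
    (h : ∀ P : Submodule R A, P.FG → ∃ r : I →ₗ[R] A, ∀ x ∈ P, r (i x) = x) :
    IsAbsolutelyPure R A := by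
  intro B _ _ f hf N _ _
  refine (injective_iff_map_eq_zero _).mpr fun z hz ↦ ?_
  obtain ⟨P, hP, y, rfl⟩ := Submodule.exists_fg_le_eq_rTensor_subtype z
  obtain ⟨r, hr⟩ := h P hP
  obtain ⟨e, he⟩ := Module.Injective.out f hf i
  have hret : (r ∘ₗ e) ∘ₗ f ∘ₗ P.subtype = P.subtype := by
    ext x
    simp [he, hr x x.2]
  rw [← hret, LinearMap.rTensor_comp_apply N (r ∘ₗ e), LinearMap.rTensor_comp_apply N f, hz,
    map_zero]

theorem isAbsolutelyPure_eventuallyZero {ι : Type u} {M : ι → Type u} [∀ i, AddCommGroup (M i)]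
    [∀ i, Module R (M i)] [∀ i, Module.Injective R (M i)] (l : Filter ι) :
    IsAbsolutelyPure R (eventuallyZero R M l) := by
  classical
  refine isAbsolutelyPure_of_forall_fg_exists_retraction (eventuallyZero R M l).subtype
    fun P hP ↦ ?_
  let Vanishes (i : ι) : Prop := ∀ x ∈ P.map (eventuallyZero R M l).subtype, x i = 0
  have hl : ∀ᶠ i in l, Vanishes i :=
    eventually_forall_mem_apply_eq_zero (hP.map _) (Submodule.map_subtype_le _ P)
  let truncate : (∀ i, M i) →ₗ[R] eventuallyZero R M l :=
    (LinearMap.pi fun i ↦ if Vanishes i then 0 else LinearMap.proj i).codRestrict _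
      fun x ↦ hl.mono fun i hi ↦ by simp [hi]
  refine ⟨truncate, fun x hx ↦ Subtype.ext (funext fun i ↦ ?_)⟩
  change (if Vanishes i then 0 else LinearMap.proj i : (∀ i, M i) →ₗ[R] M i) x.1 = x.1 i
  split_ifs with hi
  · exact (hi x ⟨x, hx, rfl⟩).symm
  · rfl

open Filter in
theorem IsFPProjective.fg_ker {F M : Type u} [AddCommGroup F] [Module R F] [Module.Finite R F]
    [AddCommGroup M] [Module R M] (hM : IsFPProjective R M) (g : F →ₗ[R] M)
    (hg : Function.Surjective g) : (LinearMap.ker g).FG := by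
  let K := LinearMap.ker g
  choose I _ _ _ i hi using
    fun P : {P : Submodule R K // P.FG} ↦ exists_injective_embedding R (K ⧸ P.1)
  let A := eventuallyZero R I atTop
  let φ : K →ₗ[R] A := (LinearMap.pi fun P ↦ i P ∘ₗ P.1.mkQ).codRestrict A fun x ↦
    (eventually_mkQ_apply_eq_zero x).mono fun P hP ↦ by
      rw [LinearMap.pi_apply, LinearMap.comp_apply, hP, map_zero]
  obtain ⟨ψ, hψ⟩ := exists_extension_of_subsingleton_ext g hg
    (hM A (isAbsolutelyPure_eventuallyZero atTop)) φ
  have hrange : LinearMap.range (A.subtype ∘ₗ ψ) ≤ A :=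
    (LinearMap.range_comp_le_range ψ A.subtype).trans A.range_subtype.le
  obtain ⟨P, hP⟩ := (eventually_forall_mem_apply_eq_zero
    (Module.Finite.iff_fg.mp inferInstance) hrange).exists
  have hPtop : P.1 = ⊤ := eq_top_iff.mpr fun x _ ↦ by
    have hψx : (ψ x).1 P = i P (P.1.mkQ x) :=
      congr_fun (congrArg Subtype.val (LinearMap.congr_fun hψ x)) P
    have hx : i P (P.1.mkQ x) = 0 := hψx.symm.trans (hP _ ⟨x.1, rfl⟩)
    exact (Submodule.Quotient.mk_eq_zero _).mp ((map_eq_zero_iff _ (hi P)).mp hx)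
  exact Module.Finite.iff_fg.mp ⟨hPtop ▸ P.2⟩

theorem IsFPProjective.finitePresentation {M : Type u} [AddCommGroup M] [Module R M]
    [Module.Finite R M] (hM : IsFPProjective R M) : Module.FinitePresentation R M := by
  obtain ⟨F, _, _, _, _, g, hg⟩ := Module.exists_finite_presentation R M
  exact Module.finitePresentation_of_free_of_surjective g hg (hM.fg_ker g hg)

end AbsolutelyPure

section GVIdeal

variable {R : Type u} [CommRing R] {I J : Ideal R}

theorem mul_apply_comm_of_ideal (f : J →ₗ[R] R) (a b : J) : (a : R) * f b = b * f a := by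
  rw [← smul_eq_mul, ← smul_eq_mul, ← map_smul, ← map_smul]
  exact congrArg f (Subtype.ext (mul_comm _ _))

theorem IsGVIdeal.eq_zero_of_forall_mul_eq_zero (hJ : IsGVIdeal J) {r : R}
    (h : ∀ a ∈ J, r * a = 0) : r = 0 :=
  hJ.2.1 (LinearMap.ext fun x ↦ by simpa using h x x.2)

theorem isGVIdeal_top (R : Type u) [CommRing R] : IsGVIdeal (⊤ : Ideal R) := by
  refine ⟨Ideal.fg_top R, fun r s h ↦ ?_, fun f ↦ ⟨f ⟨1, trivial⟩, LinearMap.ext fun x ↦ ?_⟩⟩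
  · simpa using LinearMap.congr_fun h ⟨1, trivial⟩
  · simpa [mul_comm] using mul_apply_comm_of_ideal f x ⟨1, trivial⟩

theorem IsWIdeal.eq_top_of_isGVIdeal_le (hI : IsWIdeal I) (hJ : IsGVIdeal J) (hJI : J ≤ I) :
    I = ⊤ := by
  have hker : LinearMap.ker J.mkQ = J := J.ker_mkQ
  obtain ⟨ψ, hψ⟩ := exists_extension_of_subsingleton_ext J.mkQ J.mkQ_surjective (hI.2 J hJ)
    (Submodule.inclusion (hker.le.trans hJI))
  have hψ_one : (ψ 1 : R) - 1 = 0 := hJ.eq_zero_of_forall_mul_eq_zero fun a ha ↦ by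
    have hψa : ψ a = ⟨a, hJI ha⟩ := LinearMap.congr_fun hψ ⟨a, hker.ge ha⟩
    have hsmul : ψ a = a • ψ 1 := by rw [← map_smul, smul_eq_mul, mul_one]
    have ha_mul : a = a * (ψ 1 : R) := congrArg Subtype.val (hψa.symm.trans hsmul)
    linear_combination -ha_mul
  rw [Ideal.eq_top_iff_one, ← sub_eq_zero.mp hψ_one]
  exact (ψ 1).2

theorem isDWRing_iff_forall_isGVIdeal_eq_top :
    IsDWRing R ↔ ∀ J : Ideal R, IsGVIdeal J → J = ⊤ := by
  refine ⟨fun h J hJ ↦ (h J).eq_top_of_isGVIdeal_le hJ le_rfl, fun h I ↦ ⟨?_, fun J hJ ↦ ?_⟩⟩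
  · refine Set.eq_singleton_iff_unique_mem.mpr
      ⟨⟨⊤, isGVIdeal_top R, fun a _ ↦ smul_zero a⟩, fun x ⟨J, hJ, hx⟩ ↦ ?_⟩
    simpa using hx 1 (h J hJ ▸ trivial)
  · have : Subsingleton (R ⧸ J) := Ideal.Quotient.subsingleton_iff.mpr (h J hJ)
    have : Projective (ModuleCat.of R (R ⧸ J)) :=
      (ModuleCat.isZero_of_subsingleton (ModuleCat.of R (R ⧸ J))).projective
    exact ⟨fun a b ↦ by rw [a.eq_zero_of_projective, b.eq_zero_of_projective]⟩

theorem isGVIdeal_of_span_singleton_lt (hJ : J.FG) {x : R} (hx : Prime x)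
    (hx0 : x ∈ nonZeroDivisors R) (hlt : Ideal.span {x} < J) : IsGVIdeal J := by
  have hxJ : x ∈ J := hlt.le (Ideal.mem_span_singleton_self x)
  refine ⟨hJ, fun r s h ↦ ?_, fun f ↦ ?_⟩
  · exact (mul_cancel_right_mem_nonZeroDivisors hx0).mp
      (by simpa using LinearMap.congr_fun h ⟨x, hxJ⟩)
  · obtain ⟨y, hyJ, hyx⟩ := SetLike.exists_of_lt hlt
    have hdvd : x ∣ y * f ⟨x, hxJ⟩ := ⟨_, (mul_apply_comm_of_ideal f ⟨x, hxJ⟩ ⟨y, hyJ⟩).symm⟩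
    obtain ⟨r, hr⟩ : x ∣ f ⟨x, hxJ⟩ :=
      (hx.dvd_or_dvd hdvd).resolve_left fun h ↦ hyx (Ideal.mem_span_singleton.mpr h)
    refine ⟨r, LinearMap.ext fun z ↦ (mul_cancel_left_mem_nonZeroDivisors hx0).mp ?_⟩
    calc x * (r * z) = z * f ⟨x, hxJ⟩ := by rw [hr]; ring
      _ = x * f z := mul_apply_comm_of_ideal f z ⟨x, hxJ⟩

end GVIdeal

section AbsolutelyWPure

variable {R : Type u} [CommRing R]

theorem isWPureSubmodule_of_injective {B : Type u} [AddCommGroup B] [Module R B]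
    (A : Submodule R B)
    (h : ∀ (p : Ideal R) [p.IsPrime], IsMaximalWIdeal p → ∀ (N : Type u) [AddCommGroup N]
      [Module R N], Function.Injective (LocalizedModule.map p.primeCompl (A.subtype.rTensor N))) :
    IsWPureSubmodule A := by
  refine ⟨fun p _ _ ↦ ⟨?_, ?_, ?_⟩, fun N _ _ p _ hp ↦ ⟨h p hp N, ?_, ?_⟩⟩
  · exact LocalizedModule.map_injective _ _ A.subtype_injective
  · exact LocalizedModule.map_exact _ _ _ (LinearMap.exact_subtype_mkQ A)
  · exact LocalizedModule.map_surjective _ _ A.mkQ_surjective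
  · exact LocalizedModule.map_exact _ _ _
      (rTensor_exact N (LinearMap.exact_subtype_mkQ A) A.mkQ_surjective)
  · exact LocalizedModule.map_surjective _ _ (LinearMap.rTensor_surjective N A.mkQ_surjective)

variable {A : Type u} [AddCommGroup A] [Module R A]

theorem IsAbsolutelyPure.of_linearEquiv (hA : IsAbsolutelyPure R A) {A' : Type u}
    [AddCommGroup A'] [Module R A'] (e : A ≃ₗ[R] A') : IsAbsolutelyPure R A' := by
  intro B _ _ f hf N _ _
  have hfe := hA B (f ∘ₗ e.toLinearMap) (hf.comp e.injective) N
  rw [LinearMap.rTensor_comp, LinearMap.coe_comp] at hfe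
  exact hfe.of_comp_right (e.rTensor N).surjective

theorem IsAbsolutelyPure.isAbsolutelyWPure (hA : IsAbsolutelyPure R A) :
    IsAbsolutelyWPure R A :=
  fun B _ _ f hf ↦ isWPureSubmodule_of_injective _ fun _ _ _ N _ _ ↦
    LocalizedModule.map_injective _ _ <|
      (hA.of_linearEquiv (.ofInjective f hf)) B _ (Submodule.subtype_injective _) N

theorem IsMaximalWIdeal.not_isGVIdeal_le {p J : Ideal R} (hp : IsMaximalWIdeal p)
    (hJ : IsGVIdeal J) : ¬ J ≤ p :=
  fun h ↦ hp.prop.1 (hp.prop.2.eq_top_of_isGVIdeal_le hJ h)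

theorem IsGVIdeal.isAbsolutelyWPure {J : Ideal R} (hJ : IsGVIdeal J)
    (hA : J ≤ Module.annihilator R A) : IsAbsolutelyWPure R A := by
  intro B _ _ f hf
  refine isWPureSubmodule_of_injective _ fun p _ hp N _ _ ↦ ?_
  obtain ⟨a, haJ, hap⟩ := SetLike.not_le_iff_exists.mp (hp.not_isGVIdeal_le hJ)
  have ha : a ∈ Module.annihilator R (LinearMap.range f) :=
    (LinearEquiv.ofInjective f hf).annihilator_eq ▸ hA haJ
  have hz (z : LinearMap.range f ⊗[R] N) : a • z = 0 := by
    induction z with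
    | zero => exact smul_zero a
    | add x y hx hy => rw [smul_add, hx, hy, add_zero]
    | tmul x n => rw [TensorProduct.smul_tmul', Module.mem_annihilator.mp ha x,
        TensorProduct.zero_tmul]
  have : Subsingleton (LocalizedModule p.primeCompl (LinearMap.range f ⊗[R] N)) :=
    LocalizedModule.subsingleton_iff.mpr fun z ↦ ⟨a, hap, hz z⟩
  exact Function.injective_of_subsingleton _

theorem IsWFPProjective.isFPProjective {M : Type u} [AddCommGroup M] [Module R M]
    (hM : IsWFPProjective R M) : IsFPProjective R M :=
  fun A _ _ hA ↦ hM A hA.isAbsolutelyWPure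

open IsLocalRing in
theorem IsWFPProjective.free_of_not_isDWRing [IsLocalRing R] (hR : ¬ IsDWRing R) {M : Type u}
    [AddCommGroup M] [Module R M] [Module.Finite R M] (hM : IsWFPProjective R M) :
    Module.Free R M := by
  rw [isDWRing_iff_forall_isGVIdeal_eq_top] at hR
  push Not at hR
  obtain ⟨J, hJ, hJtop⟩ := hR
  have hk : J ≤ Module.annihilator R (ResidueField R) :=
    (le_maximalIdeal hJtop).trans Ideal.annihilator_quotient.ge
  have := hM.isFPProjective.finitePresentation
  exact free_of_subsingleton_ext_residueField (hM _ (hJ.isAbsolutelyWPure hk))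

end AbsolutelyWPure

section RegularLocalRing

open IsLocalRing

variable {R : Type*} [CommRing R]

theorem exists_span_insert_sdiff_singleton_eq [IsLocalRing R] {M : Type*} [AddCommGroup M]
    [Module R M] {s : Set M} {x : M} (hx : x ∈ Submodule.span R s)
    (hx' : x ∉ maximalIdeal R • Submodule.span R s) :
    ∃ a ∈ s, Submodule.span R (insert x (s \ {a})) = Submodule.span R s := by
  classical
  obtain ⟨c, hcs, hcx⟩ := Submodule.mem_span_set.mp hx
  obtain ⟨a, ha, hca⟩ : ∃ a ∈ c.support, IsUnit (c a) := by
    by_contra! h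
    exact hx' (hcx ▸ Submodule.sum_mem _ fun a ha ↦ Submodule.smul_mem_smul
      ((mem_maximalIdeal _).mpr (h a ha)) (Submodule.subset_span (hcs ha)))
  have ha_mem : a ∈ Submodule.span R (insert x (s \ {a})) := by
    have hca_eq : c a • a = x - ∑ b ∈ c.support.erase a, c b • b := by
      rw [eq_sub_iff_add_eq, Finset.add_sum_erase _ (fun b ↦ c b • b) ha]
      exact hcx
    rw [← Submodule.smul_mem_iff_of_isUnit _ hca, hca_eq]
    refine Submodule.sub_mem _ (Submodule.subset_span (Set.mem_insert _ _))
      (Submodule.sum_mem _ fun b hb ↦ Submodule.smul_mem _ _ (Submodule.subset_span ?_))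
    obtain ⟨hba, hb⟩ := Finset.mem_erase.mp hb
    exact Set.mem_insert_of_mem _ ⟨hcs hb, hba⟩
  refine ⟨a, hcs ha, le_antisymm ?_ ?_⟩ <;> rw [Submodule.span_le]
  · exact Set.insert_subset hx (Set.sdiff_subset.trans Submodule.subset_span)
  · intro b hb
    by_cases hba : b = a
    · exact hba ▸ ha_mem
    · exact Submodule.subset_span (Set.mem_insert_of_mem _ ⟨hb, hba⟩)

theorem spanFinrank_map_quotientMk_add_one_le [IsLocalRing R] {I : Ideal R} (hI : I.FG) {x : R}
    (hx : x ∈ I) (hx' : x ∉ maximalIdeal R * I) :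
    (I.map (Ideal.Quotient.mk (Ideal.span {x}))).spanFinrank + 1 ≤ I.spanFinrank := by
  obtain ⟨s, hs_card, rfl⟩ := Submodule.FG.exists_span_finset_card_eq_spanFinrank hI
  obtain ⟨a, ha, hspan⟩ := exists_span_insert_sdiff_singleton_eq hx hx'
  let π := Ideal.Quotient.mk (Ideal.span {x})
  have hπx : π x = 0 :=
    Ideal.Quotient.eq_zero_iff_mem.mpr (Ideal.mem_span_singleton_self x)
  have hmap : Ideal.map π (Submodule.span R s) = Ideal.span (π '' (s \ {a})) := by
    rw [← hspan]
    exact (Ideal.map_span π _).trans (by rw [Set.image_insert_eq, hπx, Ideal.span_insert_zero])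
  have hfin : ((s : Set R) \ {a}).Finite := s.finite_toSet.sdiff
  calc (Ideal.map π (Submodule.span R s)).spanFinrank + 1
      ≤ (π '' (s \ {a})).ncard + 1 := by
        rw [hmap]
        exact Nat.succ_le_succ (Submodule.spanFinrank_span_le_ncard_of_finite (hfin.image π))
    _ ≤ ((s : Set R) \ {a}).ncard + 1 := Nat.succ_le_succ (Set.ncard_image_le hfin)
    _ = s.card := by rw [Set.ncard_sdiff_singleton_add_one ha, Set.ncard_coe_finset]
    _ = (Submodule.span R (s : Set R)).spanFinrank := hs_card

theorem spanFinrank_maximalIdeal_quotient_add_one_le [IsLocalRing R] [IsNoetherianRing R] {x : R}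
    [IsLocalRing (R ⧸ Ideal.span {x})] (hx : x ∈ maximalIdeal R) (hx' : x ∉ maximalIdeal R ^ 2) :
    (maximalIdeal (R ⧸ Ideal.span {x})).spanFinrank + 1 ≤ (maximalIdeal R).spanFinrank := by
  rw [← map_maximalIdeal_of_surjective _ Ideal.Quotient.mk_surjective]
  exact spanFinrank_map_quotientMk_add_one_le (maximalIdeal R).fg_of_isNoetherianRing hx
    (pow_two (maximalIdeal R) ▸ hx')

theorem eq_bot_of_le_maximalIdeal_mul [IsLocalRing R] {I : Ideal R} (hI : I.FG)
    (h : I ≤ maximalIdeal R * I) : I = ⊥ :=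
  Submodule.eq_bot_of_le_smul_of_le_jacobson_bot (maximalIdeal R) I hI h
    (jacobson_eq_maximalIdeal ⊥ bot_ne_top).ge

theorem exists_mem_maximalIdeal_forall_notMem_minimalPrimes [IsLocalRing R] [IsNoetherianRing R]
    (h : maximalIdeal R ∉ minimalPrimes R) :
    ∃ x ∈ maximalIdeal R, x ∉ maximalIdeal R ^ 2 ∧ ∀ q ∈ minimalPrimes R, x ∉ q := by
  have hsub : ¬ (maximalIdeal R : Set R) ⊆
      ⋃ I ∈ insert (maximalIdeal R ^ 2) (minimalPrimes R), (I : Set R) := by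
    refine (Ideal.subset_union_prime_finite
      ((minimalPrimes.finite_of_isNoetherianRing R).insert _) (f := id) (maximalIdeal R ^ 2)
      (maximalIdeal R ^ 2) fun I hI hne _ ↦ (hI.resolve_left hne).1.1).not.mpr ?_
    rintro ⟨I, rfl | hI, hle⟩
    · have hbot : maximalIdeal R = ⊥ := eq_bot_of_le_maximalIdeal_mul
        (maximalIdeal R).fg_of_isNoetherianRing (hle.trans_eq (pow_two _))
      exact h ⟨⟨inferInstance, bot_le⟩, fun _ _ _ ↦ hbot ▸ bot_le⟩
    · exact h (hle.antisymm (le_maximalIdeal hI.1.1.ne_top) ▸ hI)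
  obtain ⟨x, hx, hxU⟩ := Set.not_subset.mp hsub
  simp only [Set.mem_insert_iff, Set.iUnion_iUnion_eq_or_left, Set.mem_union, SetLike.mem_coe,
    Set.mem_iUnion, not_or, not_exists] at hxU
  exact ⟨x, hx, hxU⟩

theorem isDomain_of_isPrime_span_singleton [IsLocalRing R] [IsNoetherianRing R] {x : R}
    (hx : (Ideal.span {x}).IsPrime) (hxq : ∀ q ∈ minimalPrimes R, x ∉ q) : IsDomain R := by
  obtain ⟨q, hq, hqx⟩ := Ideal.exists_minimalPrimes_le (bot_le (a := Ideal.span {x}))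
  have hqm : q ≤ maximalIdeal R * q := fun y hy ↦ by
    obtain ⟨z, rfl⟩ := Ideal.mem_span_singleton.mp (hqx hy)
    exact Ideal.mul_mem_mul (le_maximalIdeal hx.ne_top (Ideal.mem_span_singleton_self x))
      ((hq.1.1.mem_or_mem hy).resolve_left (hxq q hq))
  have hq_bot := eq_bot_of_le_maximalIdeal_mul q.fg_of_isNoetherianRing hqm
  exact IsDomain.of_bot_isPrime R (hbp := hq_bot ▸ hq.1.1)

variable [IsRegularLocalRing R]

theorem isRegularLocalRing_quotient_span_singleton {x : R} (hx : x ∈ maximalIdeal R)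
    (hx' : x ∉ maximalIdeal R ^ 2) : IsRegularLocalRing (R ⧸ Ideal.span {x}) := by
  have : Nontrivial (R ⧸ Ideal.span {x}) := Ideal.Quotient.nontrivial_iff.mpr fun h ↦
    (maximalIdeal.isMaximal R).ne_top (top_le_iff.mp
      (h ▸ (Ideal.span_singleton_le_iff_mem _).mpr hx))
  have : IsLocalRing (R ⧸ Ideal.span {x}) :=
    .of_surjective' (Ideal.Quotient.mk (Ideal.span {x})) Ideal.Quotient.mk_surjective
  refine .of_spanFinrank_maximalIdeal_le _ (ENat.WithBot.add_le_add_one_right_iff.mp ?_)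
  calc ((maximalIdeal (R ⧸ Ideal.span {x})).spanFinrank : WithBot ℕ∞) + 1
      ≤ (maximalIdeal R).spanFinrank := by
        exact_mod_cast spanFinrank_maximalIdeal_quotient_add_one_le hx hx'
    _ = ringKrullDim R := IsRegularLocalRing.spanFinrank_maximalIdeal
    _ ≤ ringKrullDim (R ⧸ Ideal.span {x}) + 1 := by
      simpa using ringKrullDim_le_ringKrullDim_quotient_add_encard {x}
        (by simpa [ringJacobson_eq_maximalIdeal] using hx)

theorem maximalIdeal_eq_bot_of_mem_minimalPrimes (h : maximalIdeal R ∈ minimalPrimes R) :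
    maximalIdeal R = ⊥ := by
  have hdim : ((maximalIdeal R).spanFinrank : WithBot ℕ∞) = 0 := by
    rw [IsRegularLocalRing.spanFinrank_maximalIdeal, ← maximalIdeal_height_eq_ringKrullDim,
      Ideal.height_eq_zero_iff.mpr h]
    rfl
  exact (Submodule.spanFinrank_eq_zero_iff_eq_bot (maximalIdeal R).fg_of_isNoetherianRing).mp
    (by exact_mod_cast hdim)

variable (R) in
theorem isDomain_of_isRegularLocalRing : IsDomain R := by
  induction hn : (maximalIdeal R).spanFinrank using Nat.strong_induction_on generalizing R with
  | _ n ih =>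
  by_cases hmin : maximalIdeal R ∈ minimalPrimes R
  · exact (isField_iff_maximalIdeal_eq.mpr
      (maximalIdeal_eq_bot_of_mem_minimalPrimes hmin)).isDomain
  · obtain ⟨x, hx, hx', hxq⟩ := exists_mem_maximalIdeal_forall_notMem_minimalPrimes hmin
    have := isRegularLocalRing_quotient_span_singleton hx hx'
    have hlt : (maximalIdeal (R ⧸ Ideal.span {x})).spanFinrank < n :=
      hn ▸ spanFinrank_maximalIdeal_quotient_add_one_le hx hx'
    exact isDomain_of_isPrime_span_singleton
      ((Ideal.Quotient.isDomain_iff_prime _).mp (ih _ hlt _ rfl)) hxq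

theorem isPrime_span_singleton_of_notMem_sq {x : R} (hx : x ∈ maximalIdeal R)
    (hx' : x ∉ maximalIdeal R ^ 2) : (Ideal.span {x}).IsPrime := by
  have := isRegularLocalRing_quotient_span_singleton hx hx'
  exact (Ideal.Quotient.isDomain_iff_prime _).mp (isDomain_of_isRegularLocalRing _)

theorem not_isDWRing_of_not_isPrincipal_maximalIdeal (h : ¬ (maximalIdeal R).IsPrincipal) :
    ¬ IsDWRing R := by
  have := isDomain_of_isRegularLocalRing R
  have hmin : maximalIdeal R ∉ minimalPrimes R := fun hmin ↦
    h (maximalIdeal_eq_bot_of_mem_minimalPrimes hmin ▸ inferInstance)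
  obtain ⟨x, hx, hx', -⟩ := exists_mem_maximalIdeal_forall_notMem_minimalPrimes hmin
  have hx0 : x ≠ 0 := fun hx0 ↦ hx' (hx0 ▸ zero_mem _)
  have hprime : Prime x :=
    (Ideal.span_singleton_prime hx0).mp (isPrime_span_singleton_of_notMem_sq hx hx')
  have hlt : Ideal.span {x} < maximalIdeal R :=
    ((Ideal.span_singleton_le_iff_mem _).mpr hx).lt_of_ne fun hxm ↦ h ⟨x, hxm.symm⟩
  have hGV : IsGVIdeal (maximalIdeal R) :=
    isGVIdeal_of_span_singleton_lt (maximalIdeal R).fg_of_isNoetherianRing hprime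
      (mem_nonZeroDivisors_of_ne_zero hx0) hlt
  exact fun hR ↦ (maximalIdeal.isMaximal R).ne_top
    (isDWRing_iff_forall_isGVIdeal_eq_top.mp hR _ hGV)

end RegularLocalRing

section GlobalDimension

variable {R : Type u} [CommRing R]

theorem injective_of_surjective_of_forall_projective_ideal
    (hR : ∀ J : Ideal R, Module.Projective R J) {I Q : Type u} [AddCommGroup I] [Module R I]
    [Module.Injective R I] [AddCommGroup Q] [Module R Q] (π : I →ₗ[R] Q)
    (hπ : Function.Surjective π) : Module.Injective R Q := by
  refine Module.Baer.injective fun J g ↦ ?_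
  have := hR J
  obtain ⟨lift, hlift⟩ := Module.projective_lifting_property π g hπ
  obtain ⟨ext, hext⟩ := Module.Baer.of_injective ‹_› J lift
  exact ⟨π ∘ₗ ext, fun x hx ↦ by
    rw [LinearMap.comp_apply, hext x hx, ← LinearMap.comp_apply, hlift]⟩

theorem ringGlobalDim_le_one_of_forall_projective_ideal
    (hR : ∀ J : Ideal R, Module.Projective R J) : ringGlobalDim R ≤ 1 := by
  refine iSup_le fun M ↦ (projectiveDimension_le_iff M 1).mpr
    (hasProjectiveDimensionLT_of_enoughInjectives M 2 fun N ↦ ?_)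
  obtain ⟨I, _, _, _, i, hi⟩ := exists_injective_embedding R N
  let S := ModuleCat.shortComplexOfCompEqZero i (LinearMap.range i).mkQ
    (LinearMap.range_mkQ_comp i)
  have hS : S.ShortExact := ModuleCat.shortComplex_shortExact S
    (LinearMap.exact_map_mkQ_range i) hi (LinearMap.range i).mkQ_surjective
  have hQ : Module.Injective R (I ⧸ LinearMap.range i) :=
    injective_of_surjective_of_forall_projective_ideal hR _ (LinearMap.range i).mkQ_surjective
  have : Injective S.X₂ := (Module.injective_iff_injective_object R I).mp ‹_›
  have : Injective S.X₃ := (Module.injective_iff_injective_object R _).mp hQ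
  have hN : HasInjectiveDimensionLT S.X₁ 2 :=
    hS.hasInjectiveDimensionLT_X₁ 1 inferInstance inferInstance
  exact hN.subsingleton S.X₁ 2 2 le_rfl M

open IsLocalRing in
theorem not_isPrincipal_maximalIdeal_of_two_le_ringGlobalDim [IsDomain R] [IsLocalRing R]
    [IsNoetherianRing R] (h : 2 ≤ ringGlobalDim R) : ¬ (maximalIdeal R).IsPrincipal := by
  intro hm
  have : IsPrincipalIdealRing R :=
    ((tfae_of_isNoetherianRing_of_isLocalRing_of_isDomain R).out 4 0).mp hm
  have hdim := ringGlobalDim_le_one_of_forall_projective_ideal (R := R) fun _ ↦ inferInstance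
  exact absurd (h.trans hdim) (by decide)

end GlobalDimension

theorem mainTheorem9 {R : Type u} [CommRing R] [IsLocalRing R] :
    (¬ IsDWRing R →
      ∀ (M : Type u) [AddCommGroup M] [Module R M],
        Module.Finite R M → IsWFPProjective R M → Module.Free R M) ∧
    (IsRegularLocalRing R → 2 ≤ ringGlobalDim R → ¬ IsDWRing R) := by
  refine ⟨fun hR _ _ _ _ hM ↦ hM.free_of_not_isDWRing hR, fun _ hdim ↦ ?_⟩
  have := isDomain_of_isRegularLocalRing R
  exact not_isDWRing_of_not_isPrincipal_maximalIdeal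
    (not_isPrincipal_maximalIdeal_of_two_le_ringGlobalDim hdim)
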